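/- Let $\mathcal N$ be a finite ground set, let $f:2^{\mathcal N}\to\mathbb R_{\ge 0}$ be a non-negative submodular function, i.e. $f(A)+f(B)\ge f(A\cup B)+f(A\cap B)$ for all $A,B\subseteq\mathcal N$, and let $F(\mathbf x)=\sum_{S\subseteq\mathcal N} f(S)\prod_{i\in S}x_i\prod_{i\notin S}(1-x_i)$ be its multilinear extension. For $\mathbf x\in[0,1]^{\mathcal N}$ let $f^+(\mathbf x)$ be the concave closure of $f$: the maximum of $\sum_{S} a_S f(S)$ over all $a\in[0,1]^{2^{\mathcal N}}$ with $\sum_S a_S=1$ and $\sum_S a_S\mathbf 1_S=\mathbf x$. Let $p\in[0,1)$ and let $\mathcal P\subseteq p\cdot[0,1]^{\mathcal N}$ be a non-empty polytope that is downward-closed, i.e. $\mathbf 0\le\mathbf y\le\mathbf z\in\mathcal P$ implies $\mathbf y\in\mathcal P$. A run until time $b$ of the (continuous-time) Measured Continuous Greedy algorithm on $F$ and $\mathcal P$ is an absolutely continuous curve $\mathbf x:[0,b]\to\mathbb R^{\mathcal N}$ with $\mathbf x(0)=\mathbf 0$ such that for almost every $t\in(0,b)$ \[ \frac{dx_i}{dt}(t)=v_i(t)\,(1-x_i(t))\quad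 (i\in\mathcal N)\qquad\text{for some}\qquad \mathbf v(t)\in\arg\max_{\mathbf v\in\mathcal P}\ \sum_{i\in\mathcal N}v_i\,\bigl(F(\mathbf x(t)\vee\mathbf 1_{\{i\}})-F(\mathbf x(t))\bigr); \] its output at time $b$ is $\mathbf x(b)$. Then a run until time $1$ exists, the maximum $\max_{\mathbf z\in\mathcal P}f^+(\mathbf z)$ is attained, and for every $b\in[0,1]$ the output $\mathbf x(b)$ at time $b$ of every run until time $b$ satisfies $\mathbf x(b)\in b\cdot\mathcal P$ and \[ F(\mathbf x(b))\ \ge\ \begin{cases} b\,e^{-b}\cdot\max_{\mathbf z\in\mathcal P}f^+(\mathbf z), & 0\le b\le\ln\frac1{1-p},\\[2pt] \bigl(1-p-e^{-b}(1+\ln(1-p))\bigr)\cdot\max_{\mathbf z\in\mathcal P}f^+(\mathbf z), & \ln\frac1{1-p}\le b\le 1.\end{cases} \] -/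

import Mathlib

open scoped Pointwise

noncomputable section

namespace MeasuredGreedy

variable {N : Type*} [Fintype N] [DecidableEq N]

/-- A set function `f` on subsets of a finite ground set is submodular. -/
def Submodular (f : Finset N → ℝ) : Prop :=
  ∀ A B : Finset N, f (A ∪ B) + f (A ∩ B) ≤ f A + f B

/-- The multilinear extension `F(x) = ∑_S f(S) ∏_{i ∈ S} x_i ∏_{i ∉ S} (1 - x_i)`. -/
def multilinearExt (f : Finset N → ℝ) (x : N → ℝ) : ℝ :=
  ∑ S : Finset N, f S * ((∏ i ∈ S, x i) * ∏ i ∈ Sᶜ, (1 - x i))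

/-- The concave closure `f⁺(x)`: the maximum of `∑_S a_S f(S)` over all probability
distributions `a` on the subsets of the ground set whose vector of marginals is `x`. -/
def concaveClosure (f : Finset N → ℝ) (x : N → ℝ) : ℝ :=
  sSup {s : ℝ | ∃ a : Finset N → ℝ,
    (∀ S, a S ∈ Set.Icc (0 : ℝ) 1) ∧
    ∑ S : Finset N, a S = 1 ∧
    (∀ i : N, ∑ S : Finset N, a S * (if i ∈ S then 1 else 0) = x i) ∧
    s = ∑ S : Finset N, a S * f S}

/-- A polytope: the convex hull of finitely many points. -/
def IsPolytope (P : Set (N → ℝ)) : Prop :=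
  ∃ V : Finset (N → ℝ), P = convexHull ℝ (V : Set (N → ℝ))

/-- A set of non-negative vectors is downward-closed if it contains every non-negative vector
that is dominated by one of its elements. -/
def IsDownwardClosed (P : Set (N → ℝ)) : Prop :=
  ∀ z ∈ P, ∀ y : N → ℝ, 0 ≤ y → y ≤ z → y ∈ P

/-- The weight `F(x ∨ 1_{i}) - F(x)` that the algorithm gives to the element `i` at the point
`x ∈ [0,1]^N` (it equals `(1 - x_i) ∂_i F(x)`). -/
def weight (f : Finset N → ℝ) (x : N → ℝ) (i : N) : ℝ :=
  multilinearExt f (Function.update x i 1) - multilinearExt f x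

/-- The directions that the algorithm may choose at the point `x`: the maximizers over `P` of
the linear objective given by the weights at `x`. -/
def greedyDirections (f : Finset N → ℝ) (P : Set (N → ℝ)) (x : N → ℝ) : Set (N → ℝ) :=
  {v | v ∈ P ∧ ∀ u ∈ P, ∑ i, u i * weight f x i ≤ ∑ i, v i * weight f x i}

/-- `x` is a run of the (continuous-time) Measured Continuous Greedy algorithm for the
multilinear extension of `f` and the polytope `P` from time `0` until time `b`:
it starts at the origin, is absolutely continuous, and at almost every time `t` it moves with
velocity `dx_i/dt = v_i (1 - x_i)`, where `v` is a greedy direction at `x(t)`.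
The output of the algorithm at time `b` is `x b`. -/
structure IsMCGRun (f : Finset N → ℝ) (P : Set (N → ℝ)) (b : ℝ) (x : ℝ → N → ℝ) : Prop where
  start : x 0 = 0
  absCont : AbsolutelyContinuousOnInterval x 0 b
  velocity : ∀ᵐ t : ℝ, t ∈ Set.Ioo 0 b →
    ∃ v ∈ greedyDirections f P (x t), HasDerivAt x (fun i => v i * (1 - x t i)) t

end MeasuredGreedy

end

/-! Let `M` be the maximum of the concave closure, attained by a distribution `a` with marginals `z
∈ P`. Since v_i ≤ p, the equation x_i' = v_i (1 - x_i) keeps x_i(t) in [0, 1 - e^{-pt}]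
(`IsMCGRun.bounds`). A non-negative submodular function loses at most a factor 1 - θ when a random
set with marginals at most θ is added to its argument (`Submodular.le_sum_of_marginals_le`).
Combined with decreasing marginals and averaged over `a`, this gives ∑ z_i w_i ≥ e^{-pt} M - F(x)
for the weights w (`Submodular.le_sum_mul_weight`). The derivative of F along the run is ∑ v_i w_i,
and the greedy choice makes it at least ∑ z_i w_i. Hence (e^t F)' ≥ e^t e^{-pt} M. On [0, 1],
e^{-pt} is at least both e^{-t} and 1 - p; these agree at t = -ln(1 - p). Integrating the first
minorant before that time and the second after it yields the two cases.

Feasibility is a separation argument: each velocity lies in `P` by downward-closedness, so x(b) is b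
times an average of points of `P`. Existence of a run is an existence theorem for differential
inclusions (`exists_lipschitzWith_hasDerivAt_mem`), applicable because the maximizers over `P` form
convex compact sets that vary upper semicontinuously. -/

noncomputable section

/-! ### Submodular set functions. -/

namespace MeasuredGreedy

variable {N : Type*} [DecidableEq N]

lemma Submodular.union_right {f : Finset N → ℝ} (hf : Submodular f) (S : Finset N) :
    Submodular fun T => f (T ∪ S) := by
  intro A B
  have h := hf (A ∪ S) (B ∪ S)
  rwa [← Finset.union_union_distrib_right, ← Finset.inter_union_distrib_right] at h

/-- Marginal values are decreasing. -/
lemma Submodular.marginal_le {f : Finset N → ℝ} (hf : Submodular f) {A B : Finset N}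
    (hAB : A ⊆ B) {j : N} (hj : j ∉ B) : f (insert j B) - f B ≤ f (insert j A) - f A := by
  have h := hf (insert j A) B
  have h1 : insert j A ∪ B = insert j B := by
    rw [Finset.insert_union, Finset.union_eq_right.2 hAB]
  have h2 : insert j A ∩ B = A := by
    rw [Finset.insert_inter_of_notMem hj, Finset.inter_eq_left.2 hAB]
  rw [h1, h2] at h
  linarith

/-- Adding the elements of `S` one by one to `T` gains at least `f (T ∪ S) - f T` in total. -/
lemma Submodular.union_sub_le_sum {f : Finset N → ℝ} (hf : Submodular f) (T S : Finset N) :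
    f (T ∪ S) - f T ≤ ∑ i ∈ S, (f (insert i T) - f T) := by
  induction S using Finset.induction_on with
  | empty => simp
  | insert j S hj ih =>
    rw [Finset.sum_insert hj, Finset.union_insert]
    by_cases h : j ∈ T ∪ S
    · rw [Finset.insert_eq_self.2 h]
      by_cases hjT : j ∈ T
      · rw [Finset.insert_eq_self.2 hjT]; linarith
      · exact absurd ((Finset.mem_union.1 h).resolve_left hjT) hj
    · have := hf.marginal_le (Finset.subset_union_left : T ⊆ T ∪ S) h
      linarith

/-! ### The multilinear extension as an expectation, and its weights. -/

variable [Fintype N]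

/-- The probability that the random set containing each `i` independently with probability `x i`
is equal to `T`. -/
def prodWeight (x : N → ℝ) (T : Finset N) : ℝ :=
  (∏ i ∈ T, x i) * ∏ i ∈ Tᶜ, (1 - x i)

lemma prodWeight_nonneg {x : N → ℝ} (hx0 : ∀ i, 0 ≤ x i) (hx1 : ∀ i, x i ≤ 1) (T : Finset N) :
    0 ≤ prodWeight x T :=
  mul_nonneg (Finset.prod_nonneg fun i _ => hx0 i)
    (Finset.prod_nonneg fun i _ => sub_nonneg.2 (hx1 i))

lemma sum_prodWeight (x : N → ℝ) : ∑ T, prodWeight x T = 1 := by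
  have h := Fintype.prod_add x (fun i => 1 - x i)
  simpa [prodWeight] using h.symm

lemma multilinearExt_eq_sum_prodWeight (f : Finset N → ℝ) (x : N → ℝ) :
    multilinearExt f x = ∑ T, prodWeight x T * f T := by
  simp only [multilinearExt, prodWeight, mul_comm]

/-- The probability that the random set agrees with `T` outside of `i`. -/
def prodWeightErase (x : N → ℝ) (i : N) (T : Finset N) : ℝ :=
  (∏ j ∈ T, x j) * ∏ j ∈ (insert i T)ᶜ, (1 - x j)

/-- Conditioning on whether `i` belongs to the random set. The two inner sums do not involve `x i`,
which makes the multilinear extension affine in each coordinate. -/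
lemma sum_prodWeight_mul (x : N → ℝ) (i : N) (f : Finset N → ℝ) :
    ∑ T, prodWeight x T * f T =
      (1 - x i) * ∑ T ∈ (Finset.univ.erase i).powerset, prodWeightErase x i T * f T +
        x i * ∑ T ∈ (Finset.univ.erase i).powerset, prodWeightErase x i T * f (insert i T) := by
  have h1 : (Finset.univ : Finset (Finset N)) =
      (insert i ((Finset.univ : Finset N).erase i)).powerset := by
    rw [Finset.insert_erase (Finset.mem_univ i), Finset.powerset_univ]
  rw [h1, Finset.sum_powerset_insert (Finset.notMem_erase i _), Finset.mul_sum, Finset.mul_sum]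
  congr 1
  · refine Finset.sum_congr rfl fun T hT => ?_
    have hi : i ∉ T := fun h => Finset.notMem_erase i _ (Finset.mem_powerset.1 hT h)
    have h2 : Tᶜ = insert i (insert i T)ᶜ := by
      ext j; by_cases hj : j = i <;> simp [hj, hi]
    rw [prodWeight, prodWeightErase, h2, Finset.prod_insert (by simp)]
    ring
  · refine Finset.sum_congr rfl fun T hT => ?_
    have hi : i ∉ T := fun h => Finset.notMem_erase i _ (Finset.mem_powerset.1 hT h)
    rw [prodWeight, prodWeightErase, Finset.prod_insert hi]
    ring

lemma prodWeightErase_update (x : N → ℝ) (i : N) (s : ℝ) {T : Finset N} (hi : i ∉ T) :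
    prodWeightErase (Function.update x i s) i T = prodWeightErase x i T := by
  unfold prodWeightErase
  congr 1
  · refine Finset.prod_congr rfl fun j hj => ?_
    rw [Function.update_of_ne (ne_of_mem_of_not_mem hj hi)]
  · refine Finset.prod_congr rfl fun j hj => ?_
    rw [Function.update_of_ne]
    rintro rfl
    simp at hj

lemma multilinearExt_update (f : Finset N → ℝ) (x : N → ℝ) (i : N) (s : ℝ) :
    multilinearExt f (Function.update x i s) =
      (1 - s) * ∑ T ∈ (Finset.univ.erase i).powerset, prodWeightErase x i T * f T +
        s * ∑ T ∈ (Finset.univ.erase i).powerset, prodWeightErase x i T * f (insert i T) := by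
  rw [multilinearExt_eq_sum_prodWeight, sum_prodWeight_mul _ i, Function.update_self]
  congr 2 <;>
  · refine Finset.sum_congr rfl fun T hT => ?_
    rw [prodWeightErase_update _ _ _
      (fun h => Finset.notMem_erase i _ (Finset.mem_powerset.1 hT h))]

lemma multilinearExt_update_one (f : Finset N → ℝ) (x : N → ℝ) (i : N) :
    multilinearExt f (Function.update x i 1) = ∑ T, prodWeight x T * f (insert i T) := by
  rw [multilinearExt_update, sum_prodWeight_mul x i]
  simp only [Finset.insert_idem]
  ring

/-- The weight of `i` is the slope in the `i`-th coordinate, scaled by `1 - x i`. -/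
lemma multilinearExt_update_eq (f : Finset N → ℝ) (x : N → ℝ) (i : N) :
    ∃ c : ℝ, weight f x i = (1 - x i) * c ∧
      ∀ s, multilinearExt f (Function.update x i s) = multilinearExt f x + (s - x i) * c := by
  refine ⟨(∑ T ∈ (Finset.univ.erase i).powerset, prodWeightErase x i T * f (insert i T)) -
    ∑ T ∈ (Finset.univ.erase i).powerset, prodWeightErase x i T * f T, ?_, fun s => ?_⟩
  · have h := multilinearExt_update f x i (x i)
    rw [Function.update_eq_self] at h
    rw [weight, multilinearExt_update, h]
    ring
  · have h := multilinearExt_update f x i (x i)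
    rw [Function.update_eq_self] at h
    rw [multilinearExt_update, h]
    ring

lemma sum_prodWeight_mem (x : N → ℝ) (i : N) :
    ∑ T, prodWeight x T * (if i ∈ T then 1 else 0) = x i := by
  have h0 := sum_prodWeight_mul x i (fun _ => 1)
  simp only [mul_one, sum_prodWeight] at h0
  rw [sum_prodWeight_mul x i]
  have h1 : ∑ T ∈ (Finset.univ.erase i).powerset,
      prodWeightErase x i T * (if i ∈ T then (1 : ℝ) else 0) = 0 :=
    Finset.sum_eq_zero fun T hT => by
      rw [if_neg (fun h => Finset.notMem_erase i _ (Finset.mem_powerset.1 hT h)), mul_zero]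
  have h2 : ∑ T ∈ (Finset.univ.erase i).powerset, prodWeightErase x i T = 1 := by linarith
  simp only [h1, Finset.mem_insert_self, if_true, mul_one, h2, mul_zero, zero_add]

/-- If a random set contains each element with probability at most `θ`, then the expected value
of a non-negative submodular function on it is at least `(1 - θ) f ∅`. -/
lemma Submodular.le_sum_of_marginals_le {f : Finset N → ℝ} (hf : Submodular f)
    (hf0 : ∀ S, 0 ≤ f S) {a : Finset N → ℝ} (ha0 : ∀ T, 0 ≤ a T) (ha1 : ∑ T, a T = 1)
    {x : N → ℝ} (hax : ∀ i, ∑ T, a T * (if i ∈ T then 1 else 0) = x i) {θ : ℝ} (hθ0 : 0 ≤ θ)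
    (hθ : ∀ i, x i ≤ θ) :
    (1 - θ) * f ∅ ≤ ∑ T, a T * f T := by
  -- The ground set is built up in order of decreasing marginals, so the new element `j` has the
  -- least marginal so far. The induction hypothesis at m = x j contributes x j * f U, and the
  -- expected marginal of `j` contributes at least x j * (f (insert j U) - f U); the f U terms
  -- cancel.
  have key : ∀ U : Finset N, ∀ m, m ≤ θ → (∀ i ∈ U, m ≤ x i) →
      (1 - θ) * f ∅ + m * f U ≤ ∑ T, a T * f (T ∩ U) := by
    intro U
    induction U using Finset.induction_on_min_value x with
    | empty =>
      intro m hm _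
      simp only [Finset.inter_empty, ← Finset.sum_mul, ha1]
      nlinarith [hf0 ∅]
    | insert j U hj hmin ih =>
      intro m _ hmU
      have hmj : m ≤ x j := hmU j (Finset.mem_insert_self _ _)
      have h1 : ∀ T, a T * f (T ∩ U) + a T * (if j ∈ T then 1 else 0) * (f (insert j U) - f U) ≤
          a T * f (T ∩ insert j U) := by
        intro T
        by_cases hjT : j ∈ T
        · rw [Finset.inter_insert_of_mem hjT]
          have := hf.marginal_le (Finset.inter_subset_right : T ∩ U ⊆ U) hj
          simp only [hjT, if_true]
          nlinarith [mul_le_mul_of_nonneg_left this (ha0 T)]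
        · rw [Finset.inter_insert_of_notMem hjT]
          simp [hjT]
      have h2 := Finset.sum_le_sum fun T (_ : T ∈ Finset.univ) => h1 T
      rw [Finset.sum_add_distrib, ← Finset.sum_mul, hax] at h2
      have h3 := ih (x j) (hθ j) hmin
      nlinarith [mul_le_mul_of_nonneg_right hmj (hf0 (insert j U))]
  have h := key Finset.univ 0 hθ0 fun i _ => by
    rw [← hax i]
    exact Finset.sum_nonneg fun T _ => mul_nonneg (ha0 T) (by split_ifs <;> norm_num)
  simpa using h

/-- The total weight of the elements of `S` at a point with coordinates in `[0, θ]`. -/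
lemma Submodular.le_sum_weight {f : Finset N → ℝ} (hf : Submodular f) (hf0 : ∀ S, 0 ≤ f S)
    {x : N → ℝ} (hx0 : ∀ i, 0 ≤ x i) {θ : ℝ} (hθ0 : 0 ≤ θ) (hθ1 : θ ≤ 1) (hxθ : ∀ i, x i ≤ θ)
    (S : Finset N) :
    (1 - θ) * f S - multilinearExt f x ≤ ∑ i ∈ S, weight f x i := by
  have hw : ∀ T, 0 ≤ prodWeight x T := prodWeight_nonneg hx0 fun i => (hxθ i).trans hθ1
  -- Applied to T ↦ f (T ∪ S), whose value at ∅ is f S.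
  have h1 := (hf.union_right S).le_sum_of_marginals_le (fun T => hf0 _) hw (sum_prodWeight x)
    (sum_prodWeight_mem x) hθ0 hxθ
  rw [Finset.empty_union] at h1
  have h2 : ∑ i ∈ S, weight f x i = ∑ T, prodWeight x T * ∑ i ∈ S, (f (insert i T) - f T) := by
    simp only [weight, multilinearExt_update_one, Finset.mul_sum]
    rw [Finset.sum_comm]
    refine Finset.sum_congr rfl fun i _ => ?_
    rw [multilinearExt_eq_sum_prodWeight, ← Finset.sum_sub_distrib]
    exact Finset.sum_congr rfl fun T _ => (mul_sub _ _ _).symm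
  have h3 : ∑ T, prodWeight x T * (f (T ∪ S) - f T) ≤ ∑ i ∈ S, weight f x i := by
    rw [h2]
    exact Finset.sum_le_sum fun T _ => mul_le_mul_of_nonneg_left (hf.union_sub_le_sum T S) (hw T)
  simp only [mul_sub, Finset.sum_sub_distrib] at h3
  rw [multilinearExt_eq_sum_prodWeight]
  linarith

/-- The total weight of a fractional solution `z` is bounded from below in terms of the value of
any distribution with marginals `z`. -/
lemma Submodular.le_sum_mul_weight {f : Finset N → ℝ} (hf : Submodular f) (hf0 : ∀ S, 0 ≤ f S)
    {x : N → ℝ} (hx0 : ∀ i, 0 ≤ x i) {θ : ℝ} (hθ0 : 0 ≤ θ) (hθ1 : θ ≤ 1) (hxθ : ∀ i, x i ≤ θ)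
    {a : Finset N → ℝ} (ha0 : ∀ S, 0 ≤ a S) (ha1 : ∑ S, a S = 1) {z : N → ℝ}
    (haz : ∀ i, ∑ S, a S * (if i ∈ S then 1 else 0) = z i) :
    (1 - θ) * ∑ S, a S * f S - multilinearExt f x ≤ ∑ i, z i * weight f x i := by
  have h1 : ∑ i, z i * weight f x i = ∑ S, a S * ∑ i ∈ S, weight f x i := by
    simp only [← haz, Finset.sum_mul, Finset.mul_sum]
    rw [Finset.sum_comm]
    refine Finset.sum_congr rfl fun S _ => ?_
    simp [← Finset.mul_sum, Finset.sum_ite_mem]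
  rw [h1]
  calc (1 - θ) * ∑ S, a S * f S - multilinearExt f x
      = ∑ S, a S * ((1 - θ) * f S - multilinearExt f x) := by
        simp only [mul_sub, Finset.sum_sub_distrib, ← Finset.sum_mul, ha1, one_mul, Finset.mul_sum]
        congr 1
        exact Finset.sum_congr rfl fun S _ => by ring
    _ ≤ _ := Finset.sum_le_sum fun S _ =>
        mul_le_mul_of_nonneg_left (hf.le_sum_weight hf0 hx0 hθ0 hθ1 hxθ S) (ha0 S)

lemma contDiff_multilinearExt (f : Finset N → ℝ) {n : WithTop ℕ∞} :
    ContDiff ℝ n (multilinearExt f) := by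
  unfold multilinearExt
  fun_prop

/-- Along a coordinate line the extension is affine, so the partial derivative is the slope from
`multilinearExt_update_eq`. -/
lemma fderiv_multilinearExt_single (f : Finset N → ℝ) (x : N → ℝ) (i : N) :
    (1 - x i) * fderiv ℝ (multilinearExt f) x (Pi.single i 1) = weight f x i := by
  obtain ⟨c, hc, hs⟩ := multilinearExt_update_eq f x i
  have hF : HasFDerivAt (multilinearExt f) (fderiv ℝ (multilinearExt f) x)
      (Function.update x i (x i)) := by
    rw [Function.update_eq_self]
    exact ((contDiff_multilinearExt f (n := 1)).differentiable (by norm_num) x).hasFDerivAt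
  have h1 := hF.comp_hasDerivAt (x i) (hasDerivAt_update x i (x i))
  have h2 : HasDerivAt (fun s => multilinearExt f x + (s - x i) * c) c (x i) := by
    simpa using (((hasDerivAt_id (x i)).sub_const (x i)).mul_const c).const_add
      (multilinearExt f x)
  have h3 : multilinearExt f ∘ Function.update x i =
      fun s => multilinearExt f x + (s - x i) * c := funext hs
  rw [h3] at h1
  rw [h1.unique h2, hc]

/-- The speed at which the multilinear extension changes when moving with velocity
`v_i (1 - x_i)`. -/
lemma fderiv_multilinearExt_apply (f : Finset N → ℝ) (x v : N → ℝ) :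
    fderiv ℝ (multilinearExt f) x (fun i => v i * (1 - x i)) = ∑ i, v i * weight f x i := by
  rw [pi_eq_sum_univ' (fun i => v i * (1 - x i)), map_sum]
  refine Finset.sum_congr rfl fun i _ => ?_
  rw [map_smul, ← fderiv_multilinearExt_single f x i, smul_eq_mul, mul_assoc]

end MeasuredGreedy

/-! ### Absolutely continuous curves. -/

open Set Filter MeasureTheory
open scoped Topology NNReal

namespace AbsolutelyContinuousOnInterval

lemma lipschitzOnWith_comp {X Y : Type*} [PseudoMetricSpace X] [PseudoMetricSpace Y] {f : ℝ → X}
    {g : X → Y} {K : ℝ≥0} {s : Set X} {a b : ℝ} (hf : AbsolutelyContinuousOnInterval f a b)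
    (hg : LipschitzOnWith K g s) (hfs : MapsTo f (uIcc a b) s) :
    AbsolutelyContinuousOnInterval (fun t => g (f t)) a b := by
  rw [absolutelyContinuousOnInterval_iff] at hf ⊢
  intro ε hε
  -- Dividing by K + 1 instead of K covers K = 0.
  obtain ⟨δ, hδ, h⟩ := hf (ε / (K + 1)) (by positivity)
  refine ⟨δ, hδ, fun E hE hE' => ?_⟩
  calc ∑ i ∈ Finset.range E.1, dist (g (f (E.2 i).1)) (g (f (E.2 i).2))
      ≤ ∑ i ∈ Finset.range E.1, K * dist (f (E.2 i).1) (f (E.2 i).2) :=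
        Finset.sum_le_sum fun i hi =>
          hg.dist_le_mul _ (hfs (hE.1 i hi).1) _ (hfs (hE.1 i hi).2)
    _ = K * ∑ i ∈ Finset.range E.1, dist (f (E.2 i).1) (f (E.2 i).2) := (Finset.mul_sum _ _ _).symm
    _ ≤ K * (ε / (K + 1)) := by gcongr; exact (h E hE hE').le
    _ < (K + 1) * (ε / (K + 1)) := by gcongr; linarith
    _ = ε := by field

/-- The curve stays in a closed ball, which is compact and convex, so the C¹ map is Lipschitz there.
-/
lemma contDiff_comp {E F : Type*} [NormedAddCommGroup E] [NormedSpace ℝ E] [ProperSpace E]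
    [NormedAddCommGroup F] [NormedSpace ℝ F] {f : ℝ → E} {g : E → F} {a b : ℝ}
    (hf : AbsolutelyContinuousOnInterval f a b) (hg : ContDiff ℝ 1 g) :
    AbsolutelyContinuousOnInterval (fun t => g (f t)) a b := by
  obtain ⟨C, hC⟩ := hf.exists_bound
  obtain ⟨K, hK⟩ := hg.contDiffOn.exists_lipschitzOnWith (by decide)
    (convex_closedBall (0 : E) C) (isCompact_closedBall (0 : E) C)
  exact hf.lipschitzOnWith_comp hK fun t ht => by simpa using hC t ht

/-- An absolutely continuous function with an almost everywhere non-negative derivative does not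
decrease. -/
lemma le_of_ae_hasDerivAt_nonneg {g : ℝ → ℝ} {a b : ℝ} (hab : a ≤ b)
    (hg : AbsolutelyContinuousOnInterval g a b)
    (h : ∀ᵐ t : ℝ, t ∈ Ioo a b → ∃ d, 0 ≤ d ∧ HasDerivAt g d t) : g a ≤ g b := by
  rw [← sub_nonneg, ← hg.integral_deriv_eq_sub, intervalIntegral.integral_of_le hab,
    integral_Ioc_eq_integral_Ioo]
  refine setIntegral_nonneg_of_ae_restrict ?_
  rw [EventuallyLE, ae_restrict_iff' measurableSet_Ioo]
  filter_upwards [h] with t ht hta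
  obtain ⟨d, hd, hd'⟩ := ht hta
  simpa [hd'.deriv] using hd

end AbsolutelyContinuousOnInterval

/-! ### Bounds, feasibility and growth along a run. -/

namespace MeasuredGreedy

variable {N : Type*} [Fintype N] [DecidableEq N]

lemma IsMCGRun.mono {f : Finset N → ℝ} {P : Set (N → ℝ)} {b c : ℝ} {x : ℝ → N → ℝ}
    (h : IsMCGRun f P b x) (hc0 : 0 ≤ c) (hcb : c ≤ b) : IsMCGRun f P c x where
  start := h.start
  absCont := h.absCont.mono (by
    rw [uIcc_of_le hc0, uIcc_of_le (hc0.trans hcb)]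
    exact Icc_subset_Icc_right hcb)
  velocity := by
    filter_upwards [h.velocity] with t ht htc
    exact ht ⟨htc.1, htc.2.trans_le hcb⟩

section Bounds

variable {p : ℝ} {f : Finset N → ℝ} {P : Set (N → ℝ)} {b : ℝ} {x : ℝ → N → ℝ}

/-- The square (1 - x_i)² has derivative -2 v_i (1 - x_i)², whose sign is known before x_i ≤ 1 is.
So the square decreases, while its product with e^{2pt} increases because v_i ≤ p. -/
lemma IsMCGRun.one_sub_sq_bounds (hPp : ∀ z ∈ P, ∀ i, 0 ≤ z i ∧ z i ≤ p) (hb : 0 ≤ b)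
    (h : IsMCGRun f P b x) (i : N) :
    (1 - x b i) ^ 2 ≤ 1 ∧ Real.exp (-(p * b)) ^ 2 ≤ (1 - x b i) ^ 2 := by
  have hw : AbsolutelyContinuousOnInterval (fun t => (1 - x t i) ^ 2) 0 b :=
    h.absCont.contDiff_comp (g := fun y : N → ℝ => (1 - y i) ^ 2) (by fun_prop)
  have hder : ∀ t (v : N → ℝ), HasDerivAt x (fun i => v i * (1 - x t i)) t →
      HasDerivAt (fun t => (1 - x t i) ^ 2) (-(2 * v i * (1 - x t i) ^ 2)) t := by
    intro t v hv
    convert! (((hasDerivAt_pi.1 hv i).const_sub 1).pow 2) using 1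
    norm_num
    ring
  constructor
  · have h1 := (hw.const_mul (-1)).le_of_ae_hasDerivAt_nonneg hb (by
      filter_upwards [h.velocity] with t ht htb
      obtain ⟨v, hv, hd⟩ := ht htb
      refine ⟨_, ?_, (hder t v hd).const_mul (-1)⟩
      nlinarith [mul_nonneg (hPp v hv.1 i).1 (sq_nonneg (1 - x t i))])
    simp only [h.start, Pi.zero_apply] at h1
    linarith
  · have he : AbsolutelyContinuousOnInterval (fun t => Real.exp (2 * p * t)) 0 b :=
      ContDiffOn.absolutelyContinuousOnInterval (by fun_prop)
    have h1 := (he.mul hw).le_of_ae_hasDerivAt_nonneg hb (by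
      filter_upwards [h.velocity] with t ht htb
      obtain ⟨v, hv, hd⟩ := ht htb
      have he' : HasDerivAt (fun t => Real.exp (2 * p * t)) (Real.exp (2 * p * t) * (2 * p)) t := by
        simpa using ((hasDerivAt_id t).const_mul (2 * p)).exp
      refine ⟨_, ?_, he'.mul (hder t v hd)⟩
      have h2 : 0 ≤ Real.exp (2 * p * t) * (2 * (p - v i) * (1 - x t i) ^ 2) :=
        mul_nonneg (Real.exp_pos _).le (mul_nonneg
          (mul_nonneg zero_le_two (sub_nonneg.2 (hPp v hv.1 i).2)) (sq_nonneg _))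
      linarith)
    simp only [Pi.mul_apply, h.start, Pi.zero_apply, mul_zero, Real.exp_zero] at h1
    have h2 : Real.exp (-(p * b)) ^ 2 * Real.exp (2 * p * b) = 1 := by
      rw [← Real.exp_nat_mul, ← Real.exp_add, ← Real.exp_zero]
      congr 1
      push_cast
      ring
    have h3 := mul_le_mul_of_nonneg_left h1 (sq_nonneg (Real.exp (-(p * b))))
    rw [← mul_assoc _ (Real.exp (2 * p * b)), h2] at h3
    linarith

/-- The coordinates of a run are at most `1 - exp (-p b)` at time `b`. -/
lemma IsMCGRun.bounds (hPp : ∀ z ∈ P, ∀ i, 0 ≤ z i ∧ z i ≤ p) (hb : 0 ≤ b)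
    (h : IsMCGRun f P b x) (i : N) : 0 ≤ x b i ∧ x b i ≤ 1 - Real.exp (-(p * b)) := by
  obtain ⟨h1, h2⟩ := h.one_sub_sq_bounds hPp hb i
  -- The lower bound on the square keeps 1 - x_i away from 0; starting at 1, it cannot change sign
  -- by the intermediate value theorem.
  have hpos : 0 < 1 - x b i := by
    by_contra! hneg
    have hc : ContinuousOn (fun t => 1 - x t i) (Icc 0 b) := by
      have := h.absCont.continuousOn
      rw [uIcc_of_le hb] at this
      exact continuousOn_const.sub (continuousOn_pi.1 this i)
    obtain ⟨c, hc, hc0⟩ := intermediate_value_Icc' hb hc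
      (show (0 : ℝ) ∈ Icc (1 - x b i) (1 - x 0 i) from ⟨hneg, by simp [h.start]⟩)
    have h3 := ((h.mono hc.1 hc.2).one_sub_sq_bounds hPp hc.1 i).2
    simp only at hc0
    rw [hc0] at h3
    nlinarith [Real.exp_pos (-(p * c))]
  have h3 := abs_le_of_sq_le_sq' (show (1 - x b i) ^ 2 ≤ 1 ^ 2 by linarith) zero_le_one
  have h4 := (abs_le_of_sq_le_sq' h2 hpos.le).2
  exact ⟨by linarith, by linarith⟩

/-- The output of a run at time `b` is `b` times a feasible point. -/
lemma IsMCGRun.mem_smul (hPp : ∀ z ∈ P, ∀ i, 0 ≤ z i ∧ z i ≤ p) (hPne : P.Nonempty)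
    (hPc : Convex ℝ P) (hPcl : IsClosed P) (hPdown : IsDownwardClosed P) (hb : 0 ≤ b)
    (h : IsMCGRun f P b x) : x b ∈ b • P := by
  rcases hb.eq_or_lt with rfl | hb'
  · rw [h.start, zero_smul_set hPne]
    exact Set.zero_mem_zero
  rw [mem_smul_set_iff_inv_smul_mem₀ hb'.ne']
  by_contra hx
  -- If x(b)/b lay outside `P`, some `l` would satisfy l < u on `P` and l(x(b)) > b u. But
  -- velocities lie in `P`, so t u - l(x(t)) is non-decreasing from 0.
  obtain ⟨l, u, hl, hu⟩ := geometric_hahn_banach_closed_point hPc hPcl hx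
  have hid : AbsolutelyContinuousOnInterval (fun t : ℝ => t * u) 0 b :=
    ContDiffOn.absolutelyContinuousOnInterval (by fun_prop)
  have h1 := (hid.sub (h.absCont.contDiff_comp l.contDiff)).le_of_ae_hasDerivAt_nonneg hb (by
    filter_upwards [h.velocity] with t ht htb
    obtain ⟨v, hv, hd⟩ := ht htb
    refine ⟨_, ?_, ((hasDerivAt_id t).mul_const u).sub (l.hasFDerivAt.comp_hasDerivAt t hd)⟩
    have hxt := fun i => (h.mono htb.1.le htb.2.le).bounds hPp htb.1.le i
    have hmem : (fun i => v i * (1 - x t i)) ∈ P := by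
      refine hPdown v hv.1 _ (fun i => ?_) fun i => ?_
      · exact mul_nonneg (hPp v hv.1 i).1
          (by have := (hxt i).2; have := Real.exp_pos (-(p * t)); linarith)
      · exact mul_le_of_le_one_right (hPp v hv.1 i).1 (by have := (hxt i).1; linarith)
    have := hl _ hmem
    linarith)
  simp only [Pi.sub_apply, h.start, map_zero, zero_mul, sub_zero] at h1
  rw [map_smul, smul_eq_mul, ← div_eq_inv_mul, lt_div_iff₀ hb'] at hu
  linarith

/-- The growth of the multilinear extension along a run. -/
lemma IsMCGRun.exp_mul_sub_le (hPp : ∀ z ∈ P, ∀ i, 0 ≤ z i ∧ z i ≤ p) (hp0 : 0 ≤ p)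
    (hf : Submodular f) (hf0 : ∀ S, 0 ≤ f S) (h : IsMCGRun f P b x)
    {a : Finset N → ℝ} (ha0 : ∀ S, 0 ≤ a S) (ha1 : ∑ S, a S = 1) {z : N → ℝ} (hz : z ∈ P)
    (haz : ∀ i, ∑ S, a S * (if i ∈ S then 1 else 0) = z i) {c : ℝ} (hc : 0 ≤ c) (hcb : c ≤ b)
    {φ φ' : ℝ → ℝ} (hφ : ContDiff ℝ 1 φ) (hφ' : ∀ t, HasDerivAt φ (φ' t) t)
    (hφle : ∀ t ∈ Ioo c b, φ' t ≤ Real.exp t * (Real.exp (-(p * t)) * ∑ S, a S * f S)) :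
    Real.exp c * multilinearExt f (x c) - φ c ≤ Real.exp b * multilinearExt f (x b) - φ b := by
  have hsub : uIcc c b ⊆ uIcc 0 b := by
    rw [uIcc_of_le hcb, uIcc_of_le (hc.trans hcb)]
    exact Icc_subset_Icc_left hc
  have he : AbsolutelyContinuousOnInterval Real.exp c b :=
    ContDiffOn.absolutelyContinuousOnInterval Real.contDiff_exp.contDiffOn
  have hφ₁ : AbsolutelyContinuousOnInterval φ c b := hφ.contDiffOn.absolutelyContinuousOnInterval
  refine ((he.mul ((h.absCont.mono hsub).contDiff_comp
    (contDiff_multilinearExt f))).sub hφ₁).le_of_ae_hasDerivAt_nonneg hcb ?_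
  filter_upwards [h.velocity] with t ht htb
  have ht0 : 0 < t := hc.trans_lt htb.1
  obtain ⟨v, hv, hd⟩ := ht ⟨ht0, htb.2⟩
  have hF := ((contDiff_multilinearExt f (n := 1)).differentiable (by norm_num)
    (x t)).hasFDerivAt.comp_hasDerivAt t hd
  rw [fderiv_multilinearExt_apply] at hF
  refine ⟨_, ?_, ((Real.hasDerivAt_exp t).mul hF).sub (hφ' t)⟩
  have hxt := fun i => (h.mono ht0.le htb.2.le).bounds hPp ht0.le i
  -- With θ = 1 - e^{-pt}, so that 1 - θ = e^{-pt}. Comparing `v` with `z` then gives F' ≥ e^{-pt} ∑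
  -- a_S f(S) - F, and the factor e^t absorbs the -F.
  have h1 := hf.le_sum_mul_weight hf0 (fun i => (hxt i).1)
    (sub_nonneg.2 (Real.exp_le_one_iff.2 (by nlinarith : -(p * t) ≤ 0)))
    (by linarith [Real.exp_pos (-(p * t))]) (fun i => (hxt i).2) ha0 ha1 haz
  have h2 := h1.trans (hv.2 z hz)
  have h3 := mul_le_mul_of_nonneg_left h2 (Real.exp_pos t).le
  have h4 := hφle t htb
  simp only [sub_sub_cancel, Function.comp] at h3 ⊢
  nlinarith

end Bounds

/-- The concave closure attains its maximum on a compact set. -/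
lemma exists_isGreatest_concaveClosure {f : Finset N → ℝ} (hf0 : ∀ S, 0 ≤ f S)
    {P : Set (N → ℝ)} (hPc : IsClosed P) (h0 : (0 : N → ℝ) ∈ P) :
    ∃ a : Finset N → ℝ, (∀ S, 0 ≤ a S) ∧ ∑ S, a S = 1 ∧ ∃ z ∈ P,
      (∀ i, ∑ S, a S * (if i ∈ S then 1 else 0) = z i) ∧
      IsGreatest (concaveClosure f '' P) (∑ S, a S * f S) := by
  -- Distribution and marginal are optimized together: `K` consists of all distributions whose
  -- marginal vector lies in `P`, and the objective is linear on it.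
  let K : Set (Finset N → ℝ) := Icc 0 1 ∩ ({a | ∑ S, a S = 1} ∩
    {a | (fun i => ∑ S, a S * (if i ∈ S then (1 : ℝ) else 0)) ∈ P})
  have hK : IsCompact K := by
    refine isCompact_Icc.inter_right (IsClosed.inter ?_ ?_)
    · exact isClosed_eq (by fun_prop) continuous_const
    · exact hPc.preimage (f := fun (a : Finset N → ℝ) i =>
        ∑ S, a S * (if i ∈ S then (1 : ℝ) else 0)) (by fun_prop)
  have hKne : K.Nonempty := by
    -- The point mass at ∅ has marginal vector 0.
    refine ⟨Pi.single ∅ 1, ⟨fun S => ?_, fun S => ?_⟩, ?_, ?_⟩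
    · by_cases hS : S = ∅ <;> simp [hS]
    · by_cases hS : S = ∅ <;> simp [hS]
    · simp
    · have : (fun i => ∑ S, (Pi.single ∅ 1 : Finset N → ℝ) S * (if i ∈ S then (1 : ℝ) else 0)) =
          0 := by
        ext i
        rw [Finset.sum_eq_single ∅ (fun S _ hS => by simp [hS]) (by simp)]
        simp
      simpa only [mem_ofPred_eq, this] using h0
  obtain ⟨a, haK, hmax⟩ := hK.exists_isMaxOn hKne
    (f := fun a => ∑ S, a S * f S) (by fun_prop)
  have ha0 : ∀ S, 0 ≤ a S := haK.1.1
  have hle : ∀ z ∈ P, ∀ s ∈ {s : ℝ | ∃ a : Finset N → ℝ,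
      (∀ S, a S ∈ Set.Icc (0 : ℝ) 1) ∧ ∑ S : Finset N, a S = 1 ∧
      (∀ i : N, ∑ S : Finset N, a S * (if i ∈ S then 1 else 0) = z i) ∧
      s = ∑ S : Finset N, a S * f S}, s ≤ ∑ S, a S * f S := by
    rintro z hz s ⟨a', h1, h2, h3, rfl⟩
    refine hmax (show a' ∈ K from ⟨⟨fun S => (h1 S).1, fun S => (h1 S).2⟩, h2, ?_⟩)
    have : (fun i => ∑ S, a' S * (if i ∈ S then (1 : ℝ) else 0)) = z := funext h3
    simpa only [mem_ofPred_eq, this] using hz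
  refine ⟨a, ha0, haK.2.1, _, haK.2.2, fun i => rfl, ⟨_, haK.2.2, ?_⟩, ?_⟩
  · refine le_antisymm (Real.sSup_le (hle _ haK.2.2)
      (Finset.sum_nonneg fun S _ => mul_nonneg (ha0 S) (hf0 S))) ?_
    exact le_csSup ⟨_, hle _ haK.2.2⟩
      ⟨a, fun S => ⟨ha0 S, haK.1.2 S⟩, haK.2.1, fun i => rfl, rfl⟩
  -- If no distribution has marginals `z`, the supremum is `sSup ∅ = 0`; non-negativity of `f`
  -- covers that value.
  · rintro _ ⟨z, hz, rfl⟩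
    exact Real.sSup_le (hle z hz) (Finset.sum_nonneg fun S _ => mul_nonneg (ha0 S) (hf0 S))

end MeasuredGreedy

/-! ### Existence for differential inclusions by Euler's method. -/

section DifferentialInclusion

variable {E : Type*} [NormedAddCommGroup E] [NormedSpace ℝ E]

/-- The explicit Euler scheme with step size `h` for the vector field `g`. -/
def eulerSeq (g : E → E) (y₀ : E) (h : ℝ) : ℕ → E
  | 0 => y₀
  | k + 1 => eulerSeq g y₀ h k + h • g (eulerSeq g y₀ h k)

lemma eulerSeq_sub (g : E → E) (y₀ : E) (h : ℝ) {k l : ℕ} (hkl : k ≤ l) :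
    eulerSeq g y₀ h l - eulerSeq g y₀ h k =
      h • ∑ j ∈ Finset.Ico k l, g (eulerSeq g y₀ h j) := by
  induction l, hkl using Nat.le_induction with
  | base => simp
  | succ l hkl ih =>
    rw [Finset.sum_Ico_succ_top hkl, smul_add, ← ih, eulerSeq]
    abel

lemma eulerSeq_mem {g : E → E} {y₀ : E} {h : ℝ} {K : Set E} (hy₀ : y₀ ∈ K)
    (hK : ∀ y ∈ K, y + h • g y ∈ K) (k : ℕ) : eulerSeq g y₀ h k ∈ K := by
  induction k with
  | zero => exact hy₀
  | succ k ih => exact hK _ ih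

lemma norm_eulerSeq_sub_le {g : E → E} {y₀ : E} {h L : ℝ} (hh : 0 ≤ h) {K : Set E}
    (hL : ∀ y ∈ K, ‖g y‖ ≤ L) (hmem : ∀ k, eulerSeq g y₀ h k ∈ K) {k l : ℕ} (hkl : k ≤ l) :
    ‖eulerSeq g y₀ h l - eulerSeq g y₀ h k‖ ≤ L * (h * ((l : ℝ) - k)) := by
  rw [eulerSeq_sub g y₀ h hkl, norm_smul, Real.norm_of_nonneg hh]
  have h1 := norm_sum_le_of_le (Finset.Ico k l) (f := fun j => g (eulerSeq g y₀ h j))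
    (n := fun _ => L) fun j _ => hL _ (hmem j)
  rw [Finset.sum_const, Nat.card_Ico, nsmul_eq_mul, Nat.cast_sub hkl] at h1
  calc _ ≤ h * (((l : ℝ) - k) * L) := mul_le_mul_of_nonneg_left h1 hh
    _ = _ := by ring

/-- A difference quotient of the scheme is an average of the velocities used, so convex constraints
on velocities pass to it. -/
lemma average_eulerSeq_mem {g : E → E} {y₀ : E} {h : ℝ} (hh : 0 < h) {C : Set E}
    (hC : Convex ℝ C) {k l : ℕ} (hkl : k < l)
    (hmem : ∀ j, k ≤ j → j < l → g (eulerSeq g y₀ h j) ∈ C) :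
    (h * ((l : ℝ) - k))⁻¹ • (eulerSeq g y₀ h l - eulerSeq g y₀ h k) ∈ C := by
  have hpos : (0 : ℝ) < (l : ℝ) - k := sub_pos.2 (Nat.cast_lt.2 hkl)
  rw [eulerSeq_sub g y₀ h hkl.le, smul_smul, mul_inv, mul_comm h⁻¹, mul_assoc,
    inv_mul_cancel₀ hh.ne', mul_one, Finset.smul_sum]
  refine hC.sum_mem (fun j _ => inv_nonneg.2 hpos.le) ?_ fun j hj =>
    hmem j (Finset.mem_Ico.1 hj).1 (Finset.mem_Ico.1 hj).2
  rw [Finset.sum_const, Nat.card_Ico, nsmul_eq_mul, Nat.cast_sub hkl.le,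
    mul_inv_cancel₀ hpos.ne']

lemma tendsto_inv_mul_floor_sub_floor {s t : ℝ} (hs : 0 ≤ s) (ht : 0 ≤ t) :
    Tendsto (fun n : ℕ => (n : ℝ)⁻¹ * ((⌊t * n⌋₊ : ℝ) - ⌊s * n⌋₊)) atTop (𝓝 (t - s)) := by
  have h := ((tendsto_nat_floor_mul_div_atTop ht).sub
    (tendsto_nat_floor_mul_div_atTop hs)).comp tendsto_natCast_atTop_atTop
  refine h.congr fun n => ?_
  simp only [Function.comp]
  ring

/-- A differential inclusion `x' ∈ G x` with an upper semicontinuous right-hand side with convex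
closed values has a Lipschitz solution, if explicit Euler steps do not leave a compact set. -/
theorem exists_lipschitzWith_hasDerivAt_mem [FiniteDimensional ℝ E] {G : E → Set E} {K : Set E}
    (hK : IsCompact K) {y₀ : E} (hy₀ : y₀ ∈ K) (hne : ∀ y ∈ K, (G y).Nonempty)
    (hconv : ∀ y ∈ K, Convex ℝ (G y)) (hclosed : ∀ y ∈ K, IsClosed (G y)) {L : ℝ≥0}
    (hL : ∀ y ∈ K, ∀ d ∈ G y, ‖d‖ ≤ L)
    (hstep : ∀ y ∈ K, ∀ d ∈ G y, ∀ h : ℝ, 0 ≤ h → h ≤ 1 → y + h • d ∈ K)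
    (husc : ∀ y ∈ K, ∀ ε > 0, ∃ δ > 0, ∀ y' ∈ K, dist y' y < δ → G y' ⊆ Metric.cthickening ε (G y)) :
    ∃ x : ℝ → E, x 0 = y₀ ∧ LipschitzWith L x ∧ (∀ t, x t ∈ K) ∧
      ∀ᵐ t : ℝ, 0 < t → ∃ d ∈ G (x t), HasDerivAt x d t := by
  choose! g hg using hne
  let Y : ℕ → ℕ → E := fun n => eulerSeq g y₀ (n : ℝ)⁻¹
  have hYK : ∀ n k, Y n k ∈ K := fun n => eulerSeq_mem hy₀ fun y hy =>
    hstep y hy _ (hg y hy) _ (by positivity) (Nat.cast_inv_le_one n)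
  -- Limits along a fixed ultrafilter exist at all times simultaneously by compactness of `K`, so no
  -- subsequence has to be extracted. Time t corresponds to step ⌊t n⌋ of the scheme with step 1/n.
  let U : Ultrafilter ℕ := hyperfilter ℕ
  have hU : (U : Filter ℕ) ≤ atTop := by
    rw [← Nat.cofinite_eq_atTop]
    exact hyperfilter_le_cofinite
  have hlim : ∀ t : ℝ, ∃ y ∈ K, Tendsto (fun n => Y n ⌊t * n⌋₊) U (𝓝 y) := fun t =>
    hK.ultrafilter_le_nhds' (U.map fun n => Y n ⌊t * n⌋₊)
      (Filter.mem_map.2 (Filter.univ_mem' fun n => hYK n _))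
  choose x hxK hx using hlim
  have hlip' : ∀ n k l, k ≤ l → dist (Y n l) (Y n k) ≤ L * ((n : ℝ)⁻¹ * ((l : ℝ) - k)) :=
    fun n k l hkl => by
      rw [dist_eq_norm]
      exact norm_eulerSeq_sub_le (by positivity) (fun y hy => hL y hy _ (hg y hy)) (hYK n) hkl
  have hneg : ∀ t ≤ 0, x t = y₀ := fun t ht => by
    refine tendsto_nhds_unique (hx t) (tendsto_const_nhds.congr fun n => ?_)
    rw [Nat.floor_of_nonpos (mul_nonpos_of_nonpos_of_nonneg ht (Nat.cast_nonneg n))]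
    rfl
  have hfloor : ∀ s t : ℝ, s ≤ t → ∀ n : ℕ, ⌊s * n⌋₊ ≤ ⌊t * n⌋₊ := fun s t hst n =>
    Nat.floor_mono (mul_le_mul_of_nonneg_right hst (Nat.cast_nonneg n))
  have hlip₁ : ∀ s t : ℝ, 0 ≤ s → s ≤ t → dist (x t) (x s) ≤ L * (t - s) := by
    intro s t hs hst
    refine le_of_tendsto_of_tendsto ((hx t).dist (hx s))
      (((tendsto_inv_mul_floor_sub_floor hs (hs.trans hst)).mono_left hU).const_mul (L : ℝ))
      (Eventually.of_forall fun n => hlip' n _ _ (hfloor s t hst n))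
  have hlip₂ : ∀ s t : ℝ, s ≤ t → dist (x t) (x s) ≤ L * (t - s) := by
    intro s t hst
    rcases le_total 0 s with hs | hs
    · exact hlip₁ s t hs hst
    rcases le_total 0 t with ht | ht
    · rw [hneg s hs, ← hneg 0 le_rfl]
      exact (hlip₁ 0 t le_rfl ht).trans (mul_le_mul_of_nonneg_left (by linarith) L.2)
    · rw [hneg s hs, hneg t ht, dist_self]
      exact mul_nonneg L.2 (sub_nonneg.2 hst)
  have hlip : LipschitzWith L x := LipschitzWith.of_dist_le_mul fun s t => by
    rcases le_total s t with hst | hst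
    · rw [dist_comm, dist_comm s, Real.dist_eq, abs_of_nonneg (sub_nonneg.2 hst)]
      exact hlip₂ s t hst
    · rw [Real.dist_eq, abs_of_nonneg (sub_nonneg.2 hst)]
      exact hlip₂ t s hst
  refine ⟨x, hneg 0 le_rfl, hlip, hxK, ?_⟩
  filter_upwards [hlip.ae_differentiableAt_real] with t htd ht
  refine ⟨deriv x t, ?_, htd.hasDerivAt⟩
  -- It suffices to place the derivative in every closed thickening of G (x t). The derivative is a
  -- limit of quotients over [t, t + h], and each of these is a limit of Euler quotients.
  rw [← (hclosed _ (hxK t)).closure_eq, Metric.closure_eq_iInter_cthickening]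
  refine mem_iInter₂.2 fun ε hε => ?_
  obtain ⟨δ, hδ, hδG⟩ := husc (x t) (hxK t) ε hε
  have hslope := htd.hasDerivAt.tendsto_slope_zero_right
  refine Metric.isClosed_cthickening.mem_of_tendsto hslope ?_
  have hsmall : ∀ᶠ h : ℝ in 𝓝[>] 0, (L : ℝ) * h < δ / 2 := by
    have : Tendsto (fun h : ℝ => (L : ℝ) * h) (𝓝[>] 0) (𝓝 (L * 0)) :=
      (tendsto_const_nhds.mul tendsto_id).mono_left nhdsWithin_le_nhds
    exact this.eventually_lt_const (by simpa using half_pos hδ)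
  filter_upwards [hsmall, self_mem_nhdsWithin] with h hhδ (hh : 0 < h)
  have hq := (tendsto_inv_mul_floor_sub_floor ht.le (add_pos ht hh).le).mono_left hU
  rw [add_sub_cancel_left] at hq
  refine Metric.isClosed_cthickening.mem_of_tendsto
    ((hq.inv₀ hh.ne').smul ((hx (t + h)).sub (hx t))) ?_
  filter_upwards [hq.eventually_const_lt hh, (hq.const_mul (L : ℝ)).eventually_lt_const hhδ,
    Metric.tendsto_nhds.1 (hx t) _ (half_pos hδ), hU (Ioi_mem_atTop 0)] with n h1 h2 h3 hn
  have hn' : (0 : ℝ) < (n : ℝ)⁻¹ := inv_pos.2 (Nat.cast_pos.2 hn)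
  have hlt : ⌊t * n⌋₊ < ⌊(t + h) * n⌋₊ := by
    have := pos_of_mul_pos_right h1 hn'.le
    exact_mod_cast sub_pos.1 this
  -- Every Euler point between the two times is within δ of x t: less than δ/2 from the motion, less
  -- than δ/2 from convergence at time t.
  refine average_eulerSeq_mem hn' ((hconv _ (hxK t)).cthickening ε) hlt fun j hkj hjl =>
    hδG _ (hYK n j) ?_ (hg _ (hYK n j))
  have h4 := hlip' n _ _ hkj
  have h5 : (L : ℝ) * ((n : ℝ)⁻¹ * ((j : ℝ) - ⌊t * n⌋₊)) ≤
      L * ((n : ℝ)⁻¹ * ((⌊(t + h) * n⌋₊ : ℝ) - ⌊t * n⌋₊)) := by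
    have : (j : ℝ) ≤ ⌊(t + h) * n⌋₊ := by exact_mod_cast hjl.le
    gcongr
  have h6 := dist_triangle (Y n j) (Y n ⌊t * n⌋₊) (x t)
  exact h6.trans_lt (by linarith)

end DifferentialInclusion

/-! ### Existence of a run. -/

namespace MeasuredGreedy

variable {N : Type*} [Fintype N] [DecidableEq N]

lemma continuous_weight (f : Finset N → ℝ) (i : N) : Continuous fun x => weight f x i := by
  have h := (contDiff_multilinearExt f (n := 0)).continuous
  exact (h.comp (continuous_id.update i continuous_const)).sub h

lemma greedyDirections_nonempty (f : Finset N → ℝ) {P : Set (N → ℝ)} (hP : IsCompact P)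
    (hPne : P.Nonempty) (x : N → ℝ) : (greedyDirections f P x).Nonempty := by
  obtain ⟨v, hv, hmax⟩ := hP.exists_isMaxOn hPne
    (f := fun v : N → ℝ => ∑ i, v i * weight f x i) (by fun_prop)
  exact ⟨v, hv, fun u hu => hmax hu⟩

lemma isCompact_greedyDirections (f : Finset N → ℝ) {P : Set (N → ℝ)} (hP : IsCompact P)
    (x : N → ℝ) : IsCompact (greedyDirections f P x) := by
  have : greedyDirections f P x =
      P ∩ ⋂ u ∈ P, {v | ∑ i, u i * weight f x i ≤ ∑ i, v i * weight f x i} := by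
    ext v
    simp [greedyDirections]
  rw [this]
  exact hP.inter_right (isClosed_biInter fun u _ => isClosed_le continuous_const (by fun_prop))

lemma convex_greedyDirections (f : Finset N → ℝ) {P : Set (N → ℝ)} (hP : Convex ℝ P)
    (x : N → ℝ) : Convex ℝ (greedyDirections f P x) := by
  intro v hv w hw a b ha hb hab
  refine ⟨hP hv.1 hw.1 ha hb hab, fun u hu => ?_⟩
  have h : ∑ i, (a • v + b • w) i * weight f x i =
      a * ∑ i, v i * weight f x i + b * ∑ i, w i * weight f x i := by
    simp only [Finset.mul_sum, ← Finset.sum_add_distrib, Pi.add_apply, Pi.smul_apply, smul_eq_mul]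
    exact Finset.sum_congr rfl fun i _ => by ring
  rw [h]
  have h1 := mul_le_mul_of_nonneg_left (hv.2 u hu) ha
  have h2 := mul_le_mul_of_nonneg_left (hw.2 u hu) hb
  calc ∑ i, u i * weight f x i = (a + b) * ∑ i, u i * weight f x i := by rw [hab, one_mul]
    _ ≤ _ := by linarith

/-- The velocities that the algorithm may choose at the point `x`. -/
def greedyVelocities (f : Finset N → ℝ) (P : Set (N → ℝ)) (x : N → ℝ) : Set (N → ℝ) :=
  (fun v i => v i * (1 - x i)) '' greedyDirections f P x

/-- Upper semicontinuity of the argmax: if it failed, maximizers `v n` at points tending to `x`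
would, by compactness of `P`, accumulate at some `w`. The weights are continuous, so `w` is a
maximizer at `x`, and the velocities converge to that of `w`. -/
lemma greedyVelocities_subset_cthickening (f : Finset N → ℝ) {P : Set (N → ℝ)} (hP : IsCompact P)
    (x : N → ℝ) {ε : ℝ} (hε : 0 < ε) :
    ∃ δ > 0, ∀ y, dist y x < δ →
      greedyVelocities f P y ⊆ Metric.cthickening ε (greedyVelocities f P x) := by
  by_contra! hcon
  have h1 : ∀ n : ℕ, ∃ y v, dist y x < 1 / ((n : ℝ) + 1) ∧ v ∈ greedyDirections f P y ∧
      (fun i => v i * (1 - y i)) ∉ Metric.cthickening ε (greedyVelocities f P x) := by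
    intro n
    obtain ⟨y, hy, hsub⟩ := hcon (1 / ((n : ℝ) + 1)) (by positivity)
    obtain ⟨_, ⟨v, hv, rfl⟩, hd⟩ := Set.not_subset.1 hsub
    exact ⟨y, v, hy, hv, hd⟩
  choose y v hy hv hd using h1
  have hyx : Tendsto y atTop (𝓝 x) := tendsto_iff_dist_tendsto_zero.2
    (squeeze_zero (fun _ => dist_nonneg) (fun n => (hy n).le) tendsto_one_div_add_atTop_nhds_zero_nat)
  obtain ⟨w, hw, φ, hφ, hvw⟩ := hP.tendsto_subseq fun n => (hv n).1
  have hyφ := hyx.comp hφ.tendsto_atTop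
  have hwt : ∀ i, Tendsto (fun n => weight f (y (φ n)) i) atTop (𝓝 (weight f x i)) := fun i =>
    ((continuous_weight f i).tendsto x).comp hyφ
  have hvi : ∀ i, Tendsto (fun n => v (φ n) i) atTop (𝓝 (w i)) := tendsto_pi_nhds.1 hvw
  have hyi : ∀ i, Tendsto (fun n => y (φ n) i) atTop (𝓝 (x i)) := tendsto_pi_nhds.1 hyφ
  have hgw : w ∈ greedyDirections f P x := ⟨hw, fun u hu =>
    le_of_tendsto_of_tendsto (tendsto_finsetSum _ fun i _ => (hwt i).const_mul (u i))
      (tendsto_finsetSum _ fun i _ => (hvi i).mul (hwt i))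
      (Eventually.of_forall fun n => (hv (φ n)).2 u hu)⟩
  have hlim : Tendsto (fun n i => v (φ n) i * (1 - y (φ n) i)) atTop
      (𝓝 fun i => w i * (1 - x i)) :=
    tendsto_pi_nhds.2 fun i => (hvi i).mul ((hyi i).const_sub 1)
  obtain ⟨n, hn⟩ := (hlim.eventually (Metric.isOpen_thickening.mem_nhds
    (Metric.self_subset_thickening hε (greedyVelocities f P x) ⟨w, hgw, rfl⟩))).exists
  exact hd (φ n) (Metric.thickening_subset_cthickening _ _ hn)

/-- The measured continuous greedy algorithm can be run until any time. -/
theorem exists_isMCGRun (f : Finset N → ℝ) {P : Set (N → ℝ)} (hPne : P.Nonempty)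
    (hPc : IsCompact P) (hPconv : Convex ℝ P) (hP1 : ∀ z ∈ P, ∀ i, 0 ≤ z i ∧ z i ≤ 1) (b : ℝ) :
    ∃ x : ℝ → N → ℝ, IsMCGRun f P b x := by
  have hconv : ∀ y, Convex ℝ (greedyVelocities f P y) := fun y => by
    have h : (fun (v : N → ℝ) i => v i * (1 - y i)) =
        LinearMap.pi fun i => (1 - y i) • (LinearMap.proj i : (N → ℝ) →ₗ[ℝ] ℝ) := by
      ext v i
      simp [mul_comm]
    rw [greedyVelocities, h]
    exact (convex_greedyDirections f hPconv y).linear_image _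
  have hclosed : ∀ y, IsClosed (greedyVelocities f P y) := fun y =>
    ((isCompact_greedyDirections f hPc y).image (by fun_prop)).isClosed
  have hbound : ∀ y ∈ Icc (0 : N → ℝ) 1, ∀ d ∈ greedyVelocities f P y, ‖d‖ ≤ (1 : ℝ≥0) := by
    rintro y hy _ ⟨v, hv, rfl⟩
    refine (pi_norm_le_iff_of_nonneg zero_le_one).2 fun i => ?_
    have h1 := hP1 v hv.1 i
    have h2 : 0 ≤ y i := hy.1 i
    have h3 : y i ≤ 1 := hy.2 i
    rw [Real.norm_of_nonneg (mul_nonneg h1.1 (by linarith))]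
    exact mul_le_one₀ h1.2 (by linarith) (by linarith)
  -- Since h v_i ∈ [0, 1], the new coordinate is a convex combination of y_i and 1.
  have hstep : ∀ y ∈ Icc (0 : N → ℝ) 1, ∀ d ∈ greedyVelocities f P y, ∀ h : ℝ, 0 ≤ h → h ≤ 1 →
      y + h • d ∈ Icc (0 : N → ℝ) 1 := by
    rintro y hy _ ⟨v, hv, rfl⟩ h hh0 hh1
    have key : ∀ i, 0 ≤ y i + h * (v i * (1 - y i)) ∧ y i + h * (v i * (1 - y i)) ≤ 1 := by
      intro i
      have h1 := hP1 v hv.1 i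
      have h2 : 0 ≤ y i := hy.1 i
      have h3 : 0 ≤ 1 - y i := sub_nonneg.2 (hy.2 i)
      have h4 : h * v i ≤ 1 := mul_le_one₀ hh1 h1.1 h1.2
      have h5 : 0 ≤ h * v i := mul_nonneg hh0 h1.1
      rw [← mul_assoc]
      exact ⟨add_nonneg h2 (mul_nonneg h5 h3), by linarith [mul_le_mul_of_nonneg_right h4 h3]⟩
    exact ⟨fun i => (key i).1, fun i => (key i).2⟩
  obtain ⟨x, hx0, hxL, -, hx⟩ := exists_lipschitzWith_hasDerivAt_mem isCompact_Icc
    ⟨le_rfl, zero_le_one⟩ (fun y _ => (greedyDirections_nonempty f hPc hPne y).image _)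
    (fun y _ => hconv y) (fun y _ => hclosed y) hbound hstep fun y _ ε hε => by
      obtain ⟨δ, hδ, h⟩ := greedyVelocities_subset_cthickening f hPc y hε
      exact ⟨δ, hδ, fun y' _ => h y'⟩
  refine ⟨x, hx0, hxL.lipschitzOnWith.absolutelyContinuousOnInterval, ?_⟩
  filter_upwards [hx] with t ht htb
  obtain ⟨_, ⟨v, hv, rfl⟩, hd⟩ := ht htb.1
  exact ⟨v, hv, hd⟩

end MeasuredGreedy

end

/-! ### The approximation guarantee. -/

theorem theorem3 {N : Type*} [Fintype N] [DecidableEq N]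
    (p : ℝ) (hp0 : 0 ≤ p) (hp1 : p < 1)
    (f : Finset N → ℝ) (hf0 : ∀ S, 0 ≤ f S) (hf : MeasuredGreedy.Submodular f)
    (P : Set (N → ℝ)) (hPne : P.Nonempty) (hP : MeasuredGreedy.IsPolytope P)
    (hPdown : MeasuredGreedy.IsDownwardClosed P)
    (hPp : ∀ z ∈ P, ∀ i, 0 ≤ z i ∧ z i ≤ p) :
    -- the algorithm can be run on the whole time interval `[0, 1]`
    (∃ x : ℝ → N → ℝ, MeasuredGreedy.IsMCGRun f P 1 x) ∧
    -- `M` is the maximum of the concave closure over `P`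
    ∃ M : ℝ, IsGreatest (MeasuredGreedy.concaveClosure f '' P) M ∧
      -- guarantees for the output at time `b`
      ∀ b : ℝ, 0 ≤ b → b ≤ 1 →
        ∀ x : ℝ → N → ℝ, MeasuredGreedy.IsMCGRun f P b x →
          x b ∈ b • P ∧
          (b ≤ Real.log (1 / (1 - p)) →
            b * Real.exp (-b) * M ≤ MeasuredGreedy.multilinearExt f (x b)) ∧
          (Real.log (1 / (1 - p)) ≤ b →
            (1 - p - Real.exp (-b) * (1 + Real.log (1 - p))) * M ≤
              MeasuredGreedy.multilinearExt f (x b)) := by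
  obtain ⟨hPc, hPconv⟩ : IsCompact P ∧ Convex ℝ P := by
    obtain ⟨V, rfl⟩ := hP
    exact ⟨V.finite_toSet.isCompact_convexHull ℝ, convex_convexHull ℝ _⟩
  have h0 : (0 : N → ℝ) ∈ P := by
    obtain ⟨z, hz⟩ := hPne
    exact hPdown z hz 0 le_rfl fun i => (hPp z hz i).1
  refine ⟨MeasuredGreedy.exists_isMCGRun f hPne hPc hPconv
    (fun z hz i => ⟨(hPp z hz i).1, (hPp z hz i).2.trans hp1.le⟩) 1, ?_⟩
  obtain ⟨a, ha0, ha1, z, hz, haz, hM⟩ :=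
    MeasuredGreedy.exists_isGreatest_concaveClosure hf0 hPc.isClosed h0
  refine ⟨_, hM, fun b hb0 hb1 x hx => ⟨hx.mem_smul hPp hPne hPconv hPc.isClosed hPdown hb0, ?_⟩⟩
  generalize hMdef : ∑ S, a S * f S = M
  have hM0 : 0 ≤ M := hMdef ▸ Finset.sum_nonneg fun S _ => mul_nonneg (ha0 S) (hf0 S)
  have hexp : ∀ t : ℝ, Real.exp t * Real.exp (-t) = 1 := fun t => by
    rw [← Real.exp_add, add_neg_cancel, Real.exp_zero]
  -- the guarantee of the first phase
  have hlin : ∀ c, 0 ≤ c → c ≤ b →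
      c * M ≤ Real.exp c * MeasuredGreedy.multilinearExt f (x c) := by
    intro c hc0 hcb
    -- Uses e^t e^{-pt} ≥ 1, whose integral is linear in time.
    have h := (hx.mono hc0 hcb).exp_mul_sub_le hPp hp0 hf hf0 ha0 ha1 hz haz le_rfl hc0
      (φ := fun t => t * M) (φ' := fun _ => M) (by fun_prop)
      (fun t => by simpa using (hasDerivAt_id t).mul_const M) (fun t ht => by
        rw [hMdef, ← mul_assoc, ← Real.exp_add]
        refine le_mul_of_one_le_left hM0 (Real.one_le_exp ?_)
        nlinarith [ht.1])
    have hF0 : 0 ≤ MeasuredGreedy.multilinearExt f (x 0) := by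
      rw [MeasuredGreedy.multilinearExt_eq_sum_prodWeight, hx.start]
      exact Finset.sum_nonneg fun T _ => mul_nonneg
        (MeasuredGreedy.prodWeight_nonneg (fun _ => le_rfl) (fun _ => zero_le_one) T) (hf0 T)
    simp only [Real.exp_zero, zero_mul, sub_zero, one_mul] at h
    linarith
  refine ⟨fun _ => ?_, fun hb => ?_⟩
  · have h := mul_le_mul_of_nonneg_right (hlin b hb0 le_rfl) (Real.exp_pos (-b)).le
    calc b * Real.exp (-b) * M = b * M * Real.exp (-b) := by ring
      _ ≤ _ := h
      _ = Real.exp b * Real.exp (-b) * MeasuredGreedy.multilinearExt f (x b) := by ring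
      _ = _ := by rw [hexp, one_mul]
  · have hp' : 0 < 1 - p := sub_pos.2 hp1
    have hlog : Real.log (1 / (1 - p)) = -Real.log (1 - p) := by rw [one_div, Real.log_inv]
    have hc0 : 0 ≤ -Real.log (1 - p) := neg_nonneg.2 (Real.log_nonpos hp'.le (by linarith))
    rw [hlog] at hb
    have h1 := hlin _ hc0 hb
    -- From the switching time on, the minorant is e^{-pt} ≥ 1 - pt ≥ 1 - p, valid as t ≤ 1.
    have h2 := hx.exp_mul_sub_le hPp hp0 hf hf0 ha0 ha1 hz haz hc0 hb
      (φ := fun t => Real.exp t * ((1 - p) * M)) (φ' := fun t => Real.exp t * ((1 - p) * M))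
      (by fun_prop) (fun t => (Real.hasDerivAt_exp t).mul_const _) (fun t ht => by
        rw [hMdef]
        have ht0 : 0 < t := hc0.trans_lt ht.1
        have h3 : 1 - p ≤ Real.exp (-(p * t)) := by
          have := Real.add_one_le_exp (-(p * t))
          nlinarith [ht.2]
        gcongr)
    -- The value of φ at the switching time is therefore `M`, the source of the 1 in 1 + ln(1 - p).
    have hec : Real.exp (-Real.log (1 - p)) * (1 - p) = 1 := by
      rw [Real.exp_neg, Real.exp_log hp', inv_mul_cancel₀ hp'.ne']
    simp only [← mul_assoc] at h2
    rw [hec] at h2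
    have h3 : (Real.exp b * (1 - p) - (1 + Real.log (1 - p))) * M ≤
        Real.exp b * MeasuredGreedy.multilinearExt f (x b) := by linarith
    have h4 := mul_le_mul_of_nonneg_right h3 (Real.exp_pos (-b)).le
    calc (1 - p - Real.exp (-b) * (1 + Real.log (1 - p))) * M
        = (Real.exp b * Real.exp (-b) * (1 - p) - Real.exp (-b) * (1 + Real.log (1 - p))) * M := by
          rw [hexp, one_mul]
      _ = (Real.exp b * (1 - p) - (1 + Real.log (1 - p))) * M * Real.exp (-b) := by ring
      _ ≤ _ := h4
      _ = Real.exp b * Real.exp (-b) * MeasuredGreedy.multilinearExt f (x b) := by ring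
      _ = _ := by rw [hexp, one_mul]
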